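/- Let $N$ be a positive integer, let $M\ge 0$, and let $0<k_1<\dots<k_M<N$ be integers. Put $\Lambda=\{0,\dots,N\}\setminus\{k_1,\dots,k_M\}$ and let $\mathcal P(\Lambda)$ be the space of polynomials $\sum_{k\in\Lambda}c_kz^k$ with complex coefficients, regarded as a subspace of $L^1(\mathbb T)$, $\mathbb T=\{|z|=1\}$, with norm $\|f\|_1=\frac1{2\pi}\int_{\mathbb T}|f(\zeta)|\,|d\zeta|$. A point $\xi$ of the closed unit ball of a complex normed space $X$ is called exposed if there is a functional $\phi\in X^*$ of norm $1$ such that $\xi$ is the only point $x$ of the ball with $\phi(x)=1$. For $p\in\mathcal P(\Lambda)$ with $\|p\|_1=1$, let $p^*(z)=z^N\overline{p(1/\bar z)}$; let $a_1,\dots,a_n$ be the distinct common zeros of $p$ and $p^*$ in the open unit disk; let $m_j$ be the smaller of the multiplicities of $a_j$ as a zero of $p$ and of $p^*$; and put $$m=\sum_j m_j,\qquad G(z)=\prod_j(z-a_j)^{m_j}(1-\bar a_jz)^{m_j},\qquad R=p/G .$$ Let $\zeta_1,\dots,\zeta_\nu$ be the distinct zeros of $p$ on $\mathbb T$, with multiplicities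 $\lambda_j$; put $\mu_j=\lfloor\lambda_j/2\rfloor$ and $$\widetilde m=m+\sum_j\mu_j,\qquad \widetilde G(z)=G(z)\prod_j(z-\zeta_j)^{\mu_j}(1-\bar\zeta_jz)^{\mu_j},\qquad \widetilde R=p/\widetilde G .$$ ($R$ and $\widetilde R$ are polynomials.) For an integer $d\ge0$ and a polynomial $f$ with Fourier coefficients $\widehat f(r)=A(r)+iB(r)$ ($r\in\mathbb Z$; $A(r),B(r)$ real), let $\mathfrak M(d,f)$ be the real $2M\times(2d+1)$ block matrix $$\mathfrak M(d,f)=\begin{pmatrix}\mathcal A^+&\mathcal B^-\\ \mathcal B^+&-\mathcal A^-\end{pmatrix},\qquad \mathcal A^\pm_{j,l}=A(k_j+l-d)\pm A(k_j-l-d),\quad \mathcal B^\pm_{j,l}=B(k_j+l-d)\pm B(k_j-l-d),$$ where $j=1,\dots,M$, and $l=0,\dots,d$ in the plus-blocks and $l=1,\dots,d$ in the minus-blocks. Put $\mathfrak M=\mathfrak M(m,R)$ and $\widetilde{\mathfrak M}=\mathfrak M(\widetilde m,\widetilde R)$. Let $p\in\mathcal P(\Lambda)$ with $\|p\|_1=1$,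 and assume that $p$ has no multiple zeros on $\mathbb T$. Then: 1. $p$ is an exposed point of the closed unit ball of $\mathcal P(\Lambda)$ if and only if it is an extreme point of that ball; 2. $\widetilde m=m$ and $\widetilde{\mathfrak M}=\mathfrak M$; 3. $p$ is an extreme point of the ball if and only if $\operatorname{rank}\mathfrak M=2m$; 4. if $\operatorname{rank}\widetilde{\mathfrak M}=2\widetilde m$, then $p$ is an exposed point of the ball. -/

import Mathlib

open Polynomial MeasureTheory
open scoped Real

attribute [local instance] Polynomial.instTwoPiPos

namespace Fewnomial

noncomputable section

/-- `L¹` of the unit circle, with the normalized Lebesgue measure `dt / 2π`; a point of the circle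
is written `e ^ (i t)` with `t ∈ ℝ / 2πℤ`. -/
abbrev L1Circle : Type := Lp ℂ 1 (AddCircle.haarAddCircle (T := 2 * π))

/-- The restriction to the unit circle of a polynomial, as an element of `L¹`. -/
def toL1 : ℂ[X] →ₗ[ℂ] L1Circle :=
  (ContinuousMap.toLp (E := ℂ) 1 (AddCircle.haarAddCircle (T := 2 * π)) ℂ).toLinearMap ∘ₗ
    Polynomial.toAddCircle.toLinearMap

/-- `Λ = {0, …, N} \ {k₁, …, k_M}`. -/
def freqs (N : ℕ) {M : ℕ} (k : Fin M → ℕ) : Set ℕ :=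
  {n | n ≤ N ∧ ∀ j, n ≠ k j}

/-- The polynomials `∑_{k ∈ Λ} c_k z ^ k` with complex coefficients. -/
def polys (Λ : Set ℕ) : Submodule ℂ ℂ[X] where
  carrier := {p | ∀ n, n ∉ Λ → p.coeff n = 0}
  add_mem' := by
    intro p q hp hq n hn
    simp [hp n hn, hq n hn]
  zero_mem' := by
    intro n _
    simp
  smul_mem' := by
    intro c p hp n hn
    simp [hp n hn]

/-- The space `𝒫(Λ)`, viewed as a subspace of `L¹` (with the norm of `L¹`). -/
def PSpace (Λ : Set ℕ) : Submodule ℂ L1Circle :=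
  (polys Λ).map toL1

/-- A polynomial from `polys Λ`, viewed as a vector of the normed space `𝒫(Λ)`. -/
def toPSpace (Λ : Set ℕ) (p : ℂ[X]) (hp : p ∈ polys Λ) : PSpace Λ :=
  ⟨toL1 p, Submodule.mem_map_of_mem hp⟩

/-- `x` is an extreme point of the closed unit ball of `X`. -/
def IsExtremePt {X : Type*} [NormedAddCommGroup X] [Module ℝ X] (x : X) : Prop :=
  x ∈ Set.extremePoints ℝ (Metric.closedBall (0 : X) 1)

/-- `x` is an exposed point of the closed unit ball of the complex normed space `X`. -/
def IsExposedPt {X : Type*} [NormedAddCommGroup X] [NormedSpace ℂ X] (x : X) : Prop :=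
  ∃ φ : StrongDual ℂ X, ‖φ‖ = 1 ∧ {y ∈ Metric.closedBall (0 : X) 1 | φ y = 1} = {x}

/-- `p*(z) = z ^ N * conj (p (1 / conj z))`, that is, `∑_{k ≤ N} conj (c_k) z ^ (N - k)` if
`p = ∑_{k ≤ N} c_k z ^ k`. -/
def pStar (N : ℕ) (p : ℂ[X]) : ℂ[X] :=
  (p.map (starRingEnd ℂ)).reflect N

open Classical in
/-- The common zeros of `p` and `p*` in the open unit disk (for `p ≠ 0`). -/
def diskZeros (N : ℕ) (p : ℂ[X]) : Finset ℂ :=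
  p.roots.toFinset.filter fun a => ‖a‖ < 1 ∧ (pStar N p).IsRoot a

/-- The multiplicity `min (mult (a, p), mult (a, p*))`. -/
def commonMult (N : ℕ) (p : ℂ[X]) (a : ℂ) : ℕ :=
  min (p.rootMultiplicity a) ((pStar N p).rootMultiplicity a)

/-- The number `m`. -/
def m (N : ℕ) (p : ℂ[X]) : ℕ :=
  ∑ a ∈ diskZeros N p, commonMult N p a

/-- The polynomial `G(z) = ∏ (z - a_j) ^ m_j * (1 - conj a_j * z) ^ m_j`. -/
def G (N : ℕ) (p : ℂ[X]) : ℂ[X] :=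
  ∏ a ∈ diskZeros N p,
    (X - C a) ^ commonMult N p a * (1 - C (starRingEnd ℂ a) * X) ^ commonMult N p a

/-- The polynomial `R = p / G` (`G` divides `p`). -/
def R (N : ℕ) (p : ℂ[X]) : ℂ[X] :=
  p / G N p

open Classical in
/-- The zeros of `p` on the unit circle (for `p ≠ 0`). -/
def circleZeros (p : ℂ[X]) : Finset ℂ :=
  p.roots.toFinset.filter fun ζ => ‖ζ‖ = 1

/-- The integral part of half the multiplicity of the zero `ζ` of `p`. -/
def halfMult (p : ℂ[X]) (ζ : ℂ) : ℕ :=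
  p.rootMultiplicity ζ / 2

/-- The number `m̃ = m + μ`. -/
def mTilde (N : ℕ) (p : ℂ[X]) : ℕ :=
  m N p + ∑ ζ ∈ circleZeros p, halfMult p ζ

/-- The polynomial `G₀(z) = ∏ (z - ζ_j) ^ μ_j * (1 - conj ζ_j * z) ^ μ_j`. -/
def G0 (p : ℂ[X]) : ℂ[X] :=
  ∏ ζ ∈ circleZeros p,
    (X - C ζ) ^ halfMult p ζ * (1 - C (starRingEnd ℂ ζ) * X) ^ halfMult p ζ

/-- The polynomial `G̃ = G * G₀`. -/
def GTilde (N : ℕ) (p : ℂ[X]) : ℂ[X] :=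
  G N p * G0 p

/-- The polynomial `R̃ = p / G̃` (`G̃` divides `p`). -/
def RTilde (N : ℕ) (p : ℂ[X]) : ℂ[X] :=
  p / GTilde N p

/-- The `r`-th Fourier coefficient of (the restriction to the circle of) a polynomial. -/
def coefZ (f : ℂ[X]) (r : ℤ) : ℂ :=
  fourierCoeff (T := 2 * π) f.toAddCircle r

/-- The `2M × (2d+1)` block matrix
`(𝒜⁺  ℬ⁻ ; ℬ⁺  -𝒜⁻)` built from the Fourier coefficients `A(r) + i B(r)` of a polynomial `f`:
`𝒜^±_{j,l} = A(k_j + l - d) ± A(k_j - l - d)` and `ℬ^±_{j,l} = B(k_j + l - d) ± B(k_j - l - d)`,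
where `l` runs from `0` to `d` in the plus-blocks and from `1` to `d` in the minus-blocks. -/
def blockMatrix {M : ℕ} (k : Fin M → ℕ) (d : ℕ) (f : ℂ[X]) :
    Matrix (Fin M ⊕ Fin M) (Fin (d + 1) ⊕ Fin d) ℝ :=
  Matrix.fromBlocks
    (Matrix.of fun (j : Fin M) (l : Fin (d + 1)) =>
      (coefZ f ((k j : ℤ) + (l : ℕ) - d)).re + (coefZ f ((k j : ℤ) - (l : ℕ) - d)).re)
    (Matrix.of fun (j : Fin M) (l : Fin d) =>
      (coefZ f ((k j : ℤ) + ((l : ℕ) + 1) - d)).im - (coefZ f ((k j : ℤ) - ((l : ℕ) + 1) - d)).im)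
    (Matrix.of fun (j : Fin M) (l : Fin (d + 1)) =>
      (coefZ f ((k j : ℤ) + (l : ℕ) - d)).im + (coefZ f ((k j : ℤ) - (l : ℕ) - d)).im)
    (-Matrix.of fun (j : Fin M) (l : Fin d) =>
      (coefZ f ((k j : ℤ) + ((l : ℕ) + 1) - d)).re - (coefZ f ((k j : ℤ) - ((l : ℕ) + 1) - d)).re)

/-- The matrix `𝔐`, with `2M` rows and `2m + 1` columns. -/
def matM (N : ℕ) {M : ℕ} (k : Fin M → ℕ) (p : ℂ[X]) :
    Matrix (Fin M ⊕ Fin M) (Fin (m N p + 1) ⊕ Fin (m N p)) ℝ :=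
  blockMatrix k (m N p) (R N p)

/-- The matrix `𝔐̃`, with `2M` rows and `2m̃ + 1` columns. -/
def matMTilde (N : ℕ) {M : ℕ} (k : Fin M → ℕ) (p : ℂ[X]) :
    Matrix (Fin M ⊕ Fin M) (Fin (mTilde N p + 1) ⊕ Fin (mTilde N p)) ℝ :=
  blockMatrix k (mTilde N p) (RTilde N p)

end

end Fewnomial

namespace Fewnomial

open ComplexConjugate ComplexOrder

/-! Call S self-inversive of order 2m if its degree is at most 2m and S* = S for the reflection of
that order. Such S form a real space of dimension 2m + 1 containing G. The rows of 𝔐 are the real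
and imaginary parts of the coefficients of S R at the gaps k_j, so ker 𝔐 consists of those S with S
R in 𝒫(Λ). Since G R = p, the kernel contains G, and rank 2m means that it is the line ℝ G.

Extreme implies rank 2m (`rank_of_isExtremePt`): for S in the kernel, h = S/G is real and continuous
on the circle, and S R = h p. For a suitable constant c and small ε, both functions p ± ε(h - c)p
have norm 1, so extremality forces h = c.

Rank 2m implies exposed (`isExposedPt_of_rank`): integrate against conj p / |p|. If f in the ball
has value 1, then f conj p ≥ 0 on the circle, so f p* = f* p, and f vanishes at the zeros of p
there, which are simple. Comparing zeros gives f = S R with S self-inversive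
(`exists_selfInversive_mul_R`); hence S = cG, f = cp and c = 1.

Exposed points are always extreme, which closes the circle. With simple zeros every μ_j is 0, so the
objects with a tilde are those without. -/

/-! ### The reflection p ↦ p* and multiplicities of zeros -/

lemma pStar_mul {N K : ℕ} {p q : ℂ[X]} (hp : p.natDegree ≤ N) (hq : q.natDegree ≤ K) :
    pStar (N + K) (p * q) = pStar N p * pStar K q := by
  simp only [pStar, Polynomial.map_mul]
  exact reflect_mul _ _ ((natDegree_map_le).trans hp) ((natDegree_map_le).trans hq)

lemma pStar_pStar (N : ℕ) (p : ℂ[X]) : pStar N (pStar N p) = p := by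
  ext n
  simp [pStar, coeff_reflect]

lemma natDegree_pStar_le {N : ℕ} {p : ℂ[X]} (hp : p.natDegree ≤ N) :
    (pStar N p).natDegree ≤ N :=
  natDegree_reflect_le.trans (max_le le_rfl (natDegree_map_le.trans hp))

lemma pStar_ne_zero {N : ℕ} {p : ℂ[X]} (hp : p ≠ 0) : pStar N p ≠ 0 := by
  intro h
  apply hp
  rw [← pStar_pStar N p, h]
  simp [pStar]

lemma coeff_pStar {N n : ℕ} (hn : n ≤ N) (p : ℂ[X]) :
    (pStar N p).coeff n = conj (p.coeff (N - n)) := by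
  simp [pStar, coeff_reflect, revAt_le hn]

lemma eval_pStar {N : ℕ} {p : ℂ[X]} (hp : p.natDegree ≤ N) {z : ℂ} (hz : ‖z‖ = 1) :
    (pStar N p).eval z = z ^ N * conj (p.eval z) := by
  have hz0 : z ≠ 0 := by
    rintro rfl
    simp at hz
  have hc : conj z = z⁻¹ := (Complex.inv_eq_conj hz).symm
  let : Invertible (z⁻¹) := invertibleOfNonzero (inv_ne_zero hz0)
  have h := eval₂_reflect_mul_pow (RingHom.id ℂ) (z⁻¹) N (p.map (starRingEnd ℂ))
    (natDegree_map_le.trans hp)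
  simp only [invOf_eq_inv, inv_inv, inv_pow] at h
  have h2 : conj (p.eval z) = eval₂ (RingHom.id ℂ) (z⁻¹) (p.map (starRingEnd ℂ)) := by
    rw [← hc, ← eval, ← eval₂_eq_eval_map, eval₂_at_apply]
  rw [h2, ← h]
  simp only [pStar, eval]
  field_simp

lemma pStar_X_sub_C (a : ℂ) : pStar 1 (X - C a) = 1 - C (conj a) * X := by
  simp [pStar, reflect_sub]

lemma pStar_one_sub (a : ℂ) : pStar 1 (1 - C (conj a) * X) = X - C a := by
  rw [← pStar_X_sub_C, pStar_pStar]

lemma natDegree_one_sub_le (a : ℂ) : (1 - C (conj a) * X : ℂ[X]).natDegree ≤ 1 := by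
  rw [← pStar_X_sub_C]
  exact natDegree_pStar_le (natDegree_X_sub_C_le a)

lemma pStar_pow {N : ℕ} {p : ℂ[X]} (hp : p.natDegree ≤ N) (n : ℕ) :
    pStar (N * n) (p ^ n) = pStar N p ^ n := by
  induction n with
  | zero => simp [pStar]
  | succ n ih =>
    rw [Nat.mul_succ, pow_succ, pow_succ, pStar_mul _ hp, ih]
    exact natDegree_pow_le.trans (by rw [mul_comm]; gcongr)

lemma pStar_prod {ι : Type*} (s : Finset ι) (d : ι → ℕ) (f : ι → ℂ[X])
    (h : ∀ i ∈ s, (f i).natDegree ≤ d i) :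
    pStar (∑ i ∈ s, d i) (∏ i ∈ s, f i) = ∏ i ∈ s, pStar (d i) (f i) := by
  classical
  induction s using Finset.induction_on with
  | empty => simp [pStar]
  | insert i s hi ih =>
    rw [Finset.sum_insert hi, Finset.prod_insert hi, Finset.prod_insert hi, pStar_mul, ih]
    · exact fun j hj => h j (Finset.mem_insert_of_mem hj)
    · exact h i (Finset.mem_insert_self i s)
    · exact (natDegree_prod_le _ _).trans
        (Finset.sum_le_sum fun j hj => h j (Finset.mem_insert_of_mem hj))

/-- The factor (z - w)^n of p reflects to (1 - conj w z)^n, whose zero is the mirror image of w in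
the circle. Equality then follows because the reflection is an involution. -/
lemma rootMultiplicity_le_pStar {N : ℕ} {p : ℂ[X]} (hp0 : p ≠ 0) (hp : p.natDegree ≤ N)
    {w : ℂ} (hw : w ≠ 0) :
    p.rootMultiplicity w ≤ (pStar N p).rootMultiplicity (conj w)⁻¹ := by
  set n := p.rootMultiplicity w with hn
  rw [le_rootMultiplicity_iff (pStar_ne_zero hp0)]
  obtain ⟨u, hu⟩ := pow_rootMultiplicity_dvd p w
  rw [← hn] at hu
  have hu0 : u ≠ 0 := by
    rintro rfl
    simp at hu
    exact hp0 hu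
  have hdeg : p.natDegree = n + u.natDegree := by
    conv_lhs => rw [hu]
    rw [natDegree_mul (pow_ne_zero _ (X_sub_C_ne_zero w)) hu0, natDegree_pow, natDegree_X_sub_C,
      mul_one]
  have hN : N = 1 * n + (N - n) := by omega
  have hcw : conj w ≠ 0 := by simpa using hw
  have h1 : (1 - C (conj w) * X : ℂ[X]) = C (-conj w) * (X - C (conj w)⁻¹) := by
    rw [mul_sub, ← C_mul]
    simp [hcw]
    ring
  have : pStar N p = (1 - C (conj w) * X) ^ n * pStar (N - n) u := by
    conv_lhs => rw [hN, hu]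
    rw [pStar_mul _ (by omega), pStar_pow (natDegree_X_sub_C_le w), pStar_X_sub_C]
    rw [natDegree_pow, natDegree_X_sub_C]
    omega
  rw [this, h1, mul_pow]
  exact (Dvd.intro_left _ rfl).mul_right _

lemma rootMultiplicity_pStar {N : ℕ} {p : ℂ[X]} (hp0 : p ≠ 0) (hp : p.natDegree ≤ N)
    {w : ℂ} (hw : w ≠ 0) :
    (pStar N p).rootMultiplicity (conj w)⁻¹ = p.rootMultiplicity w := by
  refine le_antisymm ?_ (rootMultiplicity_le_pStar hp0 hp hw)
  have h := rootMultiplicity_le_pStar (pStar_ne_zero (N := N) hp0) (natDegree_pStar_le hp)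
    (w := (conj w)⁻¹) (by simpa using hw)
  simpa [pStar_pStar] using h

/-- The origin is the mirror image of infinity: p* vanishes there to the order by which the degree
of p falls short of N. This turns degree bounds into statements about multiplicities at 0. -/
lemma rootMultiplicity_pStar_zero {N : ℕ} {p : ℂ[X]} (hp0 : p ≠ 0) (hp : p.natDegree ≤ N) :
    (pStar N p).rootMultiplicity 0 + p.natDegree = N := by
  have hq0 : p.map (starRingEnd ℂ) ≠ 0 := by simpa using hp0
  have hqd : (p.map (starRingEnd ℂ)).natDegree = p.natDegree := natDegree_map _
  -- Reflecting the factor 1 with order N - deg p splits off the power of X; what remains has a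
  -- nonzero constant term.
  have h := reflect_mul (1 : ℂ[X]) (p.map (starRingEnd ℂ)) (F := N - p.natDegree)
    (G := p.natDegree) (by simp) hqd.le
  rw [one_mul, Nat.sub_add_cancel hp, reflect_one] at h
  have h2 : (reflect p.natDegree (p.map (starRingEnd ℂ))).rootMultiplicity 0 = 0 := by
    apply rootMultiplicity_eq_zero
    rw [IsRoot, ← coeff_zero_eq_eval_zero, coeff_reflect]
    simpa using hp0
  have h3 : reflect p.natDegree (p.map (starRingEnd ℂ)) ≠ 0 := by simpa using hp0
  rw [pStar, h, rootMultiplicity_mul (mul_ne_zero (pow_ne_zero _ X_ne_zero) h3), h2]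
  have h4 : ((X : ℂ[X]) ^ (N - p.natDegree)).rootMultiplicity 0 = N - p.natDegree := by
    simpa using rootMultiplicity_X_sub_C_pow (0 : ℂ) (N - p.natDegree)
  rw [h4]
  omega

lemma rootMultiplicity_pow' (p : ℂ[X]) (w : ℂ) (n : ℕ) :
    (p ^ n).rootMultiplicity w = n * p.rootMultiplicity w := by
  classical
  rw [← count_roots, ← count_roots, roots_pow, Multiset.count_nsmul]

lemma rootMultiplicity_prod' {ι : Type*} (s : Finset ι) (f : ι → ℂ[X]) (h : ∀ i ∈ s, f i ≠ 0)
    (w : ℂ) : (∏ i ∈ s, f i).rootMultiplicity w = ∑ i ∈ s, (f i).rootMultiplicity w := by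
  classical
  induction s using Finset.induction_on with
  | empty => simp [rootMultiplicity_eq_zero]
  | insert i s hi ih =>
    have h' : ∀ j ∈ s, f j ≠ 0 := fun j hj => h j (Finset.mem_insert_of_mem hj)
    rw [Finset.sum_insert hi, Finset.prod_insert hi, rootMultiplicity_mul, ih h']
    exact mul_ne_zero (h i (Finset.mem_insert_self i s)) (Finset.prod_ne_zero_iff.2 h')

lemma one_sub_ne_zero (a : ℂ) : (1 - C (conj a) * X : ℂ[X]) ≠ 0 := by
  rw [← pStar_X_sub_C]
  exact pStar_ne_zero (X_sub_C_ne_zero a)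

open Classical in
lemma rootMultiplicity_one_sub (a w : ℂ) :
    (1 - C (conj a) * X : ℂ[X]).rootMultiplicity w = if w * conj a = 1 then 1 else 0 := by
  split_ifs with h
  · have ha : a ≠ 0 := by
      rintro rfl
      simp at h
    have hw : w = (conj a)⁻¹ := eq_inv_of_mul_eq_one_left h
    rw [hw, ← pStar_X_sub_C, rootMultiplicity_pStar (X_sub_C_ne_zero a) (natDegree_X_sub_C_le a) ha,
      rootMultiplicity_X_sub_C_self]
  · apply rootMultiplicity_eq_zero
    intro h0
    apply h
    simp only [IsRoot, eval_sub, eval_one, eval_mul, eval_C, eval_X, sub_eq_zero] at h0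
    rw [mul_comm]
    exact h0.symm

/-! ### The divisor G and the quotient R -/

section

variable (N : ℕ) (p : ℂ[X])

lemma G_ne_zero : G N p ≠ 0 :=
  Finset.prod_ne_zero_iff.2 fun a _ =>
    mul_ne_zero (pow_ne_zero _ (X_sub_C_ne_zero a)) (pow_ne_zero _ (one_sub_ne_zero a))

lemma natDegree_G_factor_le (a : ℂ) (c : ℕ) :
    ((X - C a) ^ c * (1 - C (conj a) * X) ^ c : ℂ[X]).natDegree ≤ c + c := by
  refine natDegree_mul_le.trans (add_le_add ?_ ?_)
  · simp [natDegree_pow]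
  · exact natDegree_pow_le.trans (by simpa using Nat.mul_le_mul_left c (natDegree_one_sub_le a))

lemma natDegree_G_le : (G N p).natDegree ≤ 2 * m N p := by
  rw [G, m, Finset.mul_sum]
  refine (natDegree_prod_le _ _).trans (Finset.sum_le_sum fun a _ => ?_)
  exact (natDegree_G_factor_le a _).trans (by omega)

lemma pStar_G : pStar (2 * m N p) (G N p) = G N p := by
  rw [G, m, Finset.mul_sum, pStar_prod]
  · refine Finset.prod_congr rfl fun a _ => ?_
    set c := commonMult N p a
    rw [show 2 * c = 1 * c + 1 * c by ring, pStar_mul, pStar_pow (natDegree_X_sub_C_le a),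
      pStar_pow (natDegree_one_sub_le a), pStar_X_sub_C, pStar_one_sub, mul_comm]
    · simp [natDegree_pow]
    · exact natDegree_pow_le.trans (by simpa using Nat.mul_le_mul_left c (natDegree_one_sub_le a))
  · intro a _
    exact (natDegree_G_factor_le a _).trans (by omega)

variable {N p}

lemma commonMult_eq_zero (hp0 : p ≠ 0) {a : ℂ} (ha : ‖a‖ < 1) (h : a ∉ diskZeros N p) :
    commonMult N p a = 0 := by
  simp only [diskZeros, Finset.mem_filter, Multiset.mem_toFinset, mem_roots hp0] at h
  unfold commonMult
  by_cases h1 : p.IsRoot a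
  · rw [rootMultiplicity_eq_zero (p := pStar N p) (by tauto), min_zero]
  · rw [rootMultiplicity_eq_zero h1, zero_min]

lemma norm_lt_one_of_mem_diskZeros {a : ℂ} (h : a ∈ diskZeros N p) : ‖a‖ < 1 := by
  simp only [diskZeros, Finset.mem_filter] at h
  exact h.2.1

open Classical in
lemma rootMultiplicity_G (w : ℂ) :
    (G N p).rootMultiplicity w = ∑ a ∈ diskZeros N p,
      (commonMult N p a * (if w = a then 1 else 0) +
        commonMult N p a * (if w * conj a = 1 then 1 else 0)) := by
  have hne : ∀ a ∈ diskZeros N p,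
      ((X - C a) ^ commonMult N p a * (1 - C (conj a) * X) ^ commonMult N p a : ℂ[X]) ≠ 0 :=
    fun a _ => mul_ne_zero (pow_ne_zero _ (X_sub_C_ne_zero a)) (pow_ne_zero _ (one_sub_ne_zero a))
  rw [G, rootMultiplicity_prod' _ _ hne]
  refine Finset.sum_congr rfl fun a ha => ?_
  rw [rootMultiplicity_mul (hne a ha), rootMultiplicity_pow', rootMultiplicity_pow',
    rootMultiplicity_one_sub, rootMultiplicity_X_sub_C]

lemma rootMultiplicity_G_of_lt (hp0 : p ≠ 0) {w : ℂ} (hw : ‖w‖ < 1) :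
    (G N p).rootMultiplicity w = commonMult N p w := by
  classical
  rw [rootMultiplicity_G]
  have : ∀ a ∈ diskZeros N p, (commonMult N p a * (if w = a then 1 else 0) +
        commonMult N p a * (if w * conj a = 1 then 1 else 0)) =
        if w = a then commonMult N p a else 0 := by
    intro a ha
    have h1 : w * conj a ≠ 1 := by
      intro h
      have h2 := congrArg norm h
      have h3 := norm_lt_one_of_mem_diskZeros ha
      simp only [norm_mul, RCLike.norm_conj, norm_one] at h2
      nlinarith [norm_nonneg a, norm_nonneg w]
    simp [h1]
  rw [Finset.sum_congr rfl this, Finset.sum_ite_eq]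
  split_ifs with h
  · rfl
  · exact (commonMult_eq_zero hp0 hw h).symm

lemma rootMultiplicity_G_of_eq {w : ℂ} (hw : ‖w‖ = 1) : (G N p).rootMultiplicity w = 0 := by
  classical
  rw [rootMultiplicity_G]
  refine Finset.sum_eq_zero fun a ha => ?_
  have h3 := norm_lt_one_of_mem_diskZeros ha
  have h1 : w * conj a ≠ 1 := by
    intro h
    have h2 := congrArg norm h
    simp only [norm_mul, RCLike.norm_conj, norm_one, hw] at h2
    linarith
  have h4 : w ≠ a := by
    rintro rfl
    linarith
  simp [h1, h4]

lemma rootMultiplicity_G_conj_inv {w : ℂ} (hw : w ≠ 0) :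
    (G N p).rootMultiplicity (conj w)⁻¹ = (G N p).rootMultiplicity w := by
  conv_lhs => rw [← pStar_G]
  exact rootMultiplicity_pStar (G_ne_zero N p) (natDegree_G_le N p) hw

/-- The degree is below 2m exactly when 0 is a common zero, since 1 - conj a z is the constant 1 for
a = 0. -/
lemma natDegree_G (hp0 : p ≠ 0) : commonMult N p 0 + (G N p).natDegree = 2 * m N p := by
  have h := rootMultiplicity_pStar_zero (G_ne_zero N p) (natDegree_G_le N p)
  rwa [pStar_G, rootMultiplicity_G_of_lt hp0 (by simp)] at h

lemma dvd_of_rootMultiplicity_le {f g : ℂ[X]} (hf : f ≠ 0) (hg : g ≠ 0)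
    (h : ∀ w, f.rootMultiplicity w ≤ g.rootMultiplicity w) : f ∣ g := by
  classical
  rw [IsAlgClosed.dvd_iff_roots_le_roots hf hg, Multiset.le_iff_count]
  simpa using h

/-- A property holds in the whole plane if it holds in the closed unit disk and at the points
symmetric with respect to the circle to the nonzero points of the open disk. -/
lemma conj_inv_induction {P : ℂ → Prop} (h1 : ∀ w, ‖w‖ < 1 → P w) (h2 : ∀ w, ‖w‖ = 1 → P w)
    (h3 : ∀ w, w ≠ 0 → ‖w‖ < 1 → P (conj w)⁻¹) (w : ℂ) : P w := by
  rcases lt_trichotomy ‖w‖ 1 with h | h | h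
  · exact h1 w h
  · exact h2 w h
  · have hw : w ≠ 0 := by
      rintro rfl
      simp at h
      linarith
    have := h3 (conj w)⁻¹ (by simpa using hw) (by simpa using inv_lt_one_of_one_lt₀ h)
    simpa using this

/-- Inside the disk the minimum is bounded by the multiplicity in p; outside, by symmetry of G, it
is bounded by the multiplicity in p* at the mirror point. -/
lemma G_dvd (hp0 : p ≠ 0) (hp : p.natDegree ≤ N) : G N p ∣ p := by
  refine dvd_of_rootMultiplicity_le (G_ne_zero N p) hp0 (conj_inv_induction ?_ ?_ ?_)
  · intro w hw
    rw [rootMultiplicity_G_of_lt hp0 hw]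
    exact min_le_left _ _
  · intro w hw
    rw [rootMultiplicity_G_of_eq hw]
    exact Nat.zero_le _
  · intro w hw0 hw
    rw [rootMultiplicity_G_conj_inv hw0, rootMultiplicity_G_of_lt hp0 hw]
    refine (min_le_right _ _).trans (le_of_eq ?_)
    have := rootMultiplicity_pStar (pStar_ne_zero (N := N) hp0) (natDegree_pStar_le hp) hw0
    rw [pStar_pStar] at this
    exact this.symm

lemma G_mul_R (hp0 : p ≠ 0) (hp : p.natDegree ≤ N) : G N p * R N p = p :=
  EuclideanDomain.mul_div_cancel' (G_ne_zero N p) (G_dvd hp0 hp)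

lemma R_ne_zero (hp0 : p ≠ 0) (hp : p.natDegree ≤ N) : R N p ≠ 0 := by
  intro h
  apply hp0
  rw [← G_mul_R hp0 hp, h, mul_zero]

/-- Stronger than deg G + deg R ≤ N when p and p* share the zero 0. It keeps S R of degree at most N
for every S of degree up to 2m, even if G has smaller degree. -/
lemma natDegree_R_add_le (hp0 : p ≠ 0) (hp : p.natDegree ≤ N) :
    2 * m N p + (R N p).natDegree ≤ N := by
  have h1 := natDegree_G (N := N) hp0
  have h2 : p.natDegree = (G N p).natDegree + (R N p).natDegree := by
    conv_lhs => rw [← G_mul_R hp0 hp]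
    exact natDegree_mul (G_ne_zero N p) (R_ne_zero hp0 hp)
  have h3 := rootMultiplicity_pStar_zero hp0 hp
  have h4 : commonMult N p 0 ≤ (pStar N p).rootMultiplicity 0 := min_le_right _ _
  omega

/-- A polynomial `f` such that `f / p` is real on the circle and has no poles there is of the form
`S * R` with a self-inversive polynomial `S`. -/
lemma exists_selfInversive_mul_R (hp0 : p ≠ 0) (hp : p.natDegree ≤ N) {f : ℂ[X]}
    (hf : f.natDegree ≤ N) (hreal : f * pStar N p = pStar N f * p)
    (hcirc : f ≠ 0 → ∀ ζ : ℂ, ‖ζ‖ = 1 → p.rootMultiplicity ζ ≤ f.rootMultiplicity ζ) :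
    ∃ S : ℂ[X], S.natDegree ≤ 2 * m N p ∧ pStar (2 * m N p) S = S ∧ f = S * R N p := by
  by_cases hf0 : f = 0
  · exact ⟨0, by simp, by simp [pStar], by simp [hf0]⟩
  have hmult : ∀ w, f.rootMultiplicity w + (pStar N p).rootMultiplicity w =
      (pStar N f).rootMultiplicity w + p.rootMultiplicity w := by
    intro w
    rw [← rootMultiplicity_mul (mul_ne_zero hf0 (pStar_ne_zero hp0)), hreal,
      rootMultiplicity_mul (mul_ne_zero (pStar_ne_zero hf0) hp0)]
  have hfG : f * G N p ≠ 0 := mul_ne_zero hf0 (G_ne_zero N p)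
  -- By `hmult`, the multiplicity of f is at least the excess of that of p over that of p*; G
  -- supplies the remaining minimum of the two.
  have hdvd : p ∣ f * G N p := by
    refine dvd_of_rootMultiplicity_le hp0 hfG (conj_inv_induction ?_ ?_ ?_)
    · intro w hw
      have := hmult w
      rw [rootMultiplicity_mul hfG, rootMultiplicity_G_of_lt hp0 hw, commonMult]
      omega
    · intro w hw
      rw [rootMultiplicity_mul hfG]
      exact (hcirc hf0 w hw).trans (Nat.le_add_right _ _)
    · intro w hw0 hw
      have h1 := rootMultiplicity_pStar (pStar_ne_zero (N := N) hp0) (natDegree_pStar_le hp) hw0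
      have h2 := rootMultiplicity_pStar (pStar_ne_zero (N := N) hf0) (natDegree_pStar_le hf) hw0
      rw [pStar_pStar] at h1 h2
      have := hmult w
      rw [rootMultiplicity_mul hfG, rootMultiplicity_G_conj_inv hw0,
        rootMultiplicity_G_of_lt hp0 hw, commonMult, h1, h2]
      omega
  obtain ⟨S, hS⟩ := hdvd
  have hS0 : S ≠ 0 := by
    rintro rfl
    exact hfG (by simpa using hS)
  -- This is the same comparison at infinity, read off from the multiplicities of f* and p* at 0.
  have hdegS : S.natDegree ≤ 2 * m N p := by
    have h1 := congrArg natDegree hS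
    rw [natDegree_mul hf0 (G_ne_zero N p), natDegree_mul hp0 hS0] at h1
    have h2 := natDegree_G (N := N) hp0
    have h3 := rootMultiplicity_pStar_zero hp0 hp
    have h4 := rootMultiplicity_pStar_zero hf0 hf
    have h5 := hmult 0
    rw [commonMult] at h2
    omega
  refine ⟨S, hdegS, ?_, ?_⟩
  · have h1 : pStar N f * G N p = pStar N p * pStar (2 * m N p) S := by
      rw [← pStar_mul hp hdegS, ← hS, pStar_mul hf (natDegree_G_le N p), pStar_G]
    have h2 : pStar N p * (p * pStar (2 * m N p) S) = pStar N p * (p * S) := by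
      rw [← hS]
      calc pStar N p * (p * pStar (2 * m N p) S)
          = p * (pStar N p * pStar (2 * m N p) S) := by ring
        _ = (pStar N f * p) * G N p := by rw [← h1]; ring
        _ = pStar N p * (f * G N p) := by rw [← hreal]; ring
    exact mul_left_cancel₀ hp0 (mul_left_cancel₀ (pStar_ne_zero hp0) h2)
  · apply mul_left_cancel₀ (G_ne_zero N p)
    calc G N p * f = p * S := by rw [← hS]; ring
      _ = (G N p * R N p) * S := by rw [G_mul_R hp0 hp]
      _ = G N p * (S * R N p) := by ring

end

/-! ### Self-inversive polynomials and the kernel of the block matrix -/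

lemma coeff_X_pow_mul_eq_coefZ (f : ℂ[X]) (n r : ℕ) :
    (X ^ r * f).coeff n = coefZ f ((n : ℤ) - r) := by
  rw [coeff_X_pow_mul', coefZ, fourierCoeff_toAddCircle]
  by_cases h : r ≤ n
  · rw [if_pos h, if_pos (by omega)]
    congr 1
    omega
  · rw [if_neg h, if_neg (by omega)]

/-- The self-inversive polynomial of degree at most `2 * d` with the real coordinates `v`. -/
noncomputable def selfInversive (d : ℕ) (v : Fin (d + 1) ⊕ Fin d → ℝ) : ℂ[X] :=
  (∑ l : Fin (d + 1), C (v (Sum.inl l) : ℂ) * (X ^ (d + l) + X ^ (d - l))) +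
    ∑ l : Fin d, C (v (Sum.inr l) * Complex.I) * (X ^ (d + (l + 1)) - X ^ (d - (l + 1)))

lemma coeff_selfInversive_mul (d : ℕ) (v : Fin (d + 1) ⊕ Fin d → ℝ) (f : ℂ[X]) (n : ℕ) :
    (selfInversive d v * f).coeff n =
      (∑ l : Fin (d + 1), (v (Sum.inl l) : ℂ) *
        (coefZ f ((n : ℤ) - l - d) + coefZ f ((n : ℤ) + l - d))) +
      ∑ l : Fin d, v (Sum.inr l) * Complex.I *
        (coefZ f ((n : ℤ) - (l + 1) - d) - coefZ f ((n : ℤ) + (l + 1) - d)) := by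
  rw [selfInversive, add_mul, Finset.sum_mul, Finset.sum_mul, coeff_add, finsetSum_coeff,
    finsetSum_coeff]
  congr 1
  · refine Finset.sum_congr rfl fun l _ => ?_
    have hl : (l : ℕ) ≤ d := Nat.lt_succ_iff.1 l.2
    rw [mul_assoc, coeff_C_mul, add_mul, coeff_add, coeff_X_pow_mul_eq_coefZ,
      coeff_X_pow_mul_eq_coefZ]
    congr 3 <;> push_cast [hl] <;> ring
  · refine Finset.sum_congr rfl fun l _ => ?_
    have hl : (l : ℕ) + 1 ≤ d := l.2
    rw [mul_assoc, coeff_C_mul, sub_mul, coeff_sub, coeff_X_pow_mul_eq_coefZ,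
      coeff_X_pow_mul_eq_coefZ]
    congr 3 <;> push_cast [hl] <;> ring

lemma blockMatrix_mulVec_inl {M : ℕ} (k : Fin M → ℕ) (d : ℕ) (f : ℂ[X])
    (v : Fin (d + 1) ⊕ Fin d → ℝ) (j : Fin M) :
    (blockMatrix k d f).mulVec v (Sum.inl j) = ((selfInversive d v * f).coeff (k j)).re := by
  rw [coeff_selfInversive_mul]
  simp only [blockMatrix, Matrix.mulVec, dotProduct, Fintype.sum_sum_type, Matrix.fromBlocks_apply₁₁,
    Matrix.fromBlocks_apply₁₂, Matrix.of_apply, Complex.add_re, Complex.re_sum]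
  congr 1
  · refine Finset.sum_congr rfl fun l _ => ?_
    rw [Complex.re_ofReal_mul, Complex.add_re]
    ring
  · refine Finset.sum_congr rfl fun l _ => ?_
    rw [mul_assoc, Complex.re_ofReal_mul, Complex.I_mul_re, Complex.sub_im]
    ring

lemma blockMatrix_mulVec_inr {M : ℕ} (k : Fin M → ℕ) (d : ℕ) (f : ℂ[X])
    (v : Fin (d + 1) ⊕ Fin d → ℝ) (j : Fin M) :
    (blockMatrix k d f).mulVec v (Sum.inr j) = ((selfInversive d v * f).coeff (k j)).im := by
  rw [coeff_selfInversive_mul]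
  simp only [blockMatrix, Matrix.mulVec, dotProduct, Fintype.sum_sum_type, Matrix.fromBlocks_apply₂₁,
    Matrix.fromBlocks_apply₂₂, Matrix.of_apply, Complex.add_im, Complex.im_sum, Matrix.neg_apply]
  congr 1
  · refine Finset.sum_congr rfl fun l _ => ?_
    rw [Complex.im_ofReal_mul, Complex.add_im]
    ring
  · refine Finset.sum_congr rfl fun l _ => ?_
    rw [mul_assoc, Complex.im_ofReal_mul, Complex.I_mul_im, Complex.sub_re]
    ring

/-- This is the purpose of the matrix: its kernel is the space of self-inversive multipliers of f
whose product with f has no coefficients at the gaps. -/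
lemma blockMatrix_mulVec_eq_zero_iff {M : ℕ} (k : Fin M → ℕ) (d : ℕ) (f : ℂ[X])
    (v : Fin (d + 1) ⊕ Fin d → ℝ) :
    (blockMatrix k d f).mulVec v = 0 ↔ ∀ j, (selfInversive d v * f).coeff (k j) = 0 := by
  constructor
  · intro h j
    apply Complex.ext
    · rw [← blockMatrix_mulVec_inl, h]
      rfl
    · rw [← blockMatrix_mulVec_inr, h]
      rfl
  · intro h
    ext (j | j)
    · rw [blockMatrix_mulVec_inl, h]
      rfl
    · rw [blockMatrix_mulVec_inr, h]
      rfl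

lemma selfInversive_sub_smul (d : ℕ) (c : ℝ) (v w : Fin (d + 1) ⊕ Fin d → ℝ) :
    selfInversive d (v - c • w) = selfInversive d v - C (c : ℂ) * selfInversive d w := by
  rw [selfInversive, selfInversive, selfInversive, mul_add, Finset.mul_sum, Finset.mul_sum,
    add_sub_add_comm, ← Finset.sum_sub_distrib, ← Finset.sum_sub_distrib]
  congr 1 <;>
  · refine Finset.sum_congr rfl fun l _ => ?_
    simp only [Pi.sub_apply, Pi.smul_apply, smul_eq_mul, Complex.ofReal_sub, Complex.ofReal_mul,
      C_sub, C_mul]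
    ring

lemma natDegree_selfInversive_le (d : ℕ) (v : Fin (d + 1) ⊕ Fin d → ℝ) :
    (selfInversive d v).natDegree ≤ 2 * d := by
  refine natDegree_add_le_of_degree_le ?_ ?_
  · refine natDegree_sum_le_of_forall_le _ _ fun l _ => ?_
    refine (natDegree_C_mul_le _ _).trans (natDegree_add_le_of_degree_le ?_ ?_) <;>
    · rw [natDegree_X_pow]
      omega
  · refine natDegree_sum_le_of_forall_le _ _ fun l _ => ?_
    refine (natDegree_C_mul_le _ _).trans ((natDegree_sub_le _ _).trans (max_le ?_ ?_)) <;>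
    · rw [natDegree_X_pow]
      omega

lemma coeff_selfInversive_center (d : ℕ) (v : Fin (d + 1) ⊕ Fin d → ℝ) :
    (selfInversive d v).coeff d = 2 * v (Sum.inl 0) := by
  rw [selfInversive, coeff_add, finsetSum_coeff, finsetSum_coeff, Finset.sum_eq_single 0,
    Finset.sum_eq_zero]
  · simp
    ring
  · intro l _
    have := l.2
    rw [coeff_C_mul, coeff_sub, coeff_X_pow, coeff_X_pow, if_neg (by omega), if_neg (by omega)]
    simp
  · intro l _ hl
    have h0 : (l : ℕ) ≠ 0 := fun h => hl (Fin.ext h)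
    have := l.2
    rw [coeff_C_mul, coeff_add, coeff_X_pow, coeff_X_pow, if_neg (by omega), if_neg (by omega)]
    simp
  · simp

lemma coeff_selfInversive_upper (d : ℕ) (v : Fin (d + 1) ⊕ Fin d → ℝ) (i : Fin d) :
    (selfInversive d v).coeff (d + (i + 1)) =
      v (Sum.inl i.succ) + v (Sum.inr i) * Complex.I := by
  rw [selfInversive, coeff_add, finsetSum_coeff, finsetSum_coeff, Finset.sum_eq_single i.succ,
    Finset.sum_eq_single i]
  · rw [coeff_C_mul, coeff_C_mul, coeff_sub, coeff_add]
    simp only [coeff_X_pow, Fin.val_succ]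
    rw [if_pos trivial, if_neg (by omega)]
    simp
  · intro l _ hl
    have h0 : (l : ℕ) ≠ i := fun h => hl (Fin.ext h)
    have := l.2
    rw [coeff_C_mul, coeff_sub, coeff_X_pow, coeff_X_pow, if_neg (by omega), if_neg (by omega)]
    simp
  · simp
  · intro l _ hl
    have h0 : (l : ℕ) ≠ i + 1 := fun h => hl (Fin.ext (by simpa using h))
    have := l.2
    rw [coeff_C_mul, coeff_add, coeff_X_pow, coeff_X_pow, if_neg (by omega), if_neg (by omega)]
    simp
  · simp

lemma eq_zero_of_selfInversive_eq_zero {d : ℕ} {v : Fin (d + 1) ⊕ Fin d → ℝ}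
    (h : selfInversive d v = 0) : v = 0 := by
  have h0 := coeff_selfInversive_center d v
  have h1 := coeff_selfInversive_upper d v
  rw [h] at h0
  simp only [h, coeff_zero] at h0 h1
  ext (l | l)
  · refine Fin.cases ?_ (fun i => ?_) l
    · have : (v (Sum.inl 0) : ℂ) = 0 := by simpa using h0.symm
      exact_mod_cast this
    · simpa using (congrArg Complex.re (h1 i)).symm
  · simpa using (congrArg Complex.im (h1 l)).symm

lemma pStar_selfInversive (d : ℕ) (v : Fin (d + 1) ⊕ Fin d → ℝ) :
    pStar (2 * d) (selfInversive d v) = selfInversive d v := by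
  have hadd : ∀ p q : ℂ[X], pStar (2 * d) (p + q) = pStar (2 * d) p + pStar (2 * d) q := by
    intro p q
    simp [pStar]
  have hsum : ∀ (n : ℕ) (g : Fin n → ℂ[X]),
      pStar (2 * d) (∑ l, g l) = ∑ l, pStar (2 * d) (g l) := by
    intro n g
    exact map_sum (AddMonoidHom.mk' (pStar (2 * d)) hadd) g Finset.univ
  rw [selfInversive, hadd, hsum, hsum]
  congr 1
  · refine Finset.sum_congr rfl fun l _ => ?_
    have := l.2
    simp only [pStar, Polynomial.map_mul, map_C, Polynomial.map_add, Polynomial.map_pow, map_X,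
      reflect_C_mul, reflect_add, reflect_monomial, Complex.conj_ofReal]
    rw [revAt_le (by omega), revAt_le (by omega), show 2 * d - (d + (l : ℕ)) = d - l by omega,
      show 2 * d - (d - (l : ℕ)) = d + l by omega]
    ring
  · refine Finset.sum_congr rfl fun l _ => ?_
    have := l.2
    rw [pStar, Polynomial.map_mul, map_C, Polynomial.map_sub, Polynomial.map_pow,
      Polynomial.map_pow, map_X, reflect_C_mul, reflect_sub, reflect_monomial, reflect_monomial,
      map_mul, Complex.conj_ofReal, Complex.conj_I]
    rw [revAt_le (by omega), revAt_le (by omega), show 2 * d - (d + ((l : ℕ) + 1)) = d - (l + 1)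
      by omega, show 2 * d - (d - ((l : ℕ) + 1)) = d + (l + 1) by omega]
    rw [mul_neg, C_neg]
    ring

lemma ext_of_pStar_eq {d : ℕ} {S T : ℂ[X]}
    (hS' : pStar (2 * d) S = S) (hT' : pStar (2 * d) T = T)
    (h : ∀ n, d ≤ n → S.coeff n = T.coeff n) : S = T := by
  ext n
  by_cases hn : d ≤ n
  · exact h n hn
  · rw [← hS', ← hT', coeff_pStar (by omega), coeff_pStar (by omega), h _ (by omega)]

lemma exists_eq_selfInversive {d : ℕ} {S : ℂ[X]} (hS : S.natDegree ≤ 2 * d)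
    (hS' : pStar (2 * d) S = S) : ∃ v, selfInversive d v = S := by
  -- The central coefficient is halved because for l = 0 the two monomials of `selfInversive`
  -- coincide. The coefficients below the centre are conjugates of those above.
  refine ⟨Sum.elim (Fin.cons ((S.coeff d).re / 2) fun i => (S.coeff (d + (i + 1))).re)
    fun i => (S.coeff (d + (i + 1))).im, ?_⟩
  refine ext_of_pStar_eq (pStar_selfInversive _ _) hS' ?_
  intro n hn
  obtain ⟨i, rfl⟩ := Nat.exists_eq_add_of_le hn
  by_cases hi : i ≤ d
  · rcases i with _ | i
    · have hc : conj (S.coeff d) = S.coeff d := by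
        have := coeff_pStar (N := 2 * d) (n := d) (by omega) S
        rw [hS', show 2 * d - d = d by omega] at this
        exact this.symm
      rw [add_zero, coeff_selfInversive_center]
      simp only [Sum.elim_inl, Fin.cons_zero]
      conv_rhs => rw [← Complex.conj_eq_iff_re.1 hc]
      push_cast
      ring
    · rw [coeff_selfInversive_upper d _ ⟨i, hi⟩]
      exact Complex.re_add_im _
  · rw [coeff_eq_zero_of_natDegree_lt, coeff_eq_zero_of_natDegree_lt (by omega)]
    exact (natDegree_selfInversive_le _ _).trans_lt (by omega)

/-- Rank-nullity with 2d + 1 columns: rank 2d means a one-dimensional kernel, spanned by any nonzero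
vector in it. -/
lemma rank_blockMatrix_eq_iff {M : ℕ} (k : Fin M → ℕ) (d : ℕ) (f : ℂ[X])
    {w : Fin (d + 1) ⊕ Fin d → ℝ} (hw0 : w ≠ 0) (hw : (blockMatrix k d f).mulVec w = 0) :
    (blockMatrix k d f).rank = 2 * d ↔
      ∀ v, (blockMatrix k d f).mulVec v = 0 → ∃ c : ℝ, v = c • w := by
  have h1 := (blockMatrix k d f).mulVecLin.finrank_range_add_finrank_ker
  have h2 : Module.finrank ℝ (Fin (d + 1) ⊕ Fin d → ℝ) = 2 * d + 1 := by
    simp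
    ring
  have hw' : w ∈ LinearMap.ker (blockMatrix k d f).mulVecLin := by simpa using hw
  have h3 := finrank_eq_one_iff_of_nonzero' (K := ℝ)
    (⟨w, hw'⟩ : LinearMap.ker (blockMatrix k d f).mulVecLin) (by simpa using hw0)
  rw [h2] at h1
  have h4 : (blockMatrix k d f).rank = 2 * d ↔
      Module.finrank ℝ (LinearMap.ker (blockMatrix k d f).mulVecLin) = 1 := by
    rw [Matrix.rank]
    omega
  rw [h4, h3]
  constructor
  · intro h v hv
    obtain ⟨c, hc⟩ := h ⟨v, by simpa using hv⟩
    exact ⟨c, (congrArg Subtype.val hc).symm⟩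
  · rintro h ⟨v, hv⟩
    obtain ⟨c, hc⟩ := h v (by simpa using hv)
    exact ⟨c, Subtype.ext hc.symm⟩

/-! ### Polynomials on the circle -/

/-- The normalized Lebesgue measure of the circle. -/
noncomputable abbrev circleMeasure : Measure (AddCircle (2 * π)) :=
  AddCircle.haarAddCircle (T := 2 * π)

/-- The value of a polynomial at the point `e ^ (i t)`. -/
noncomputable abbrev circleEval (f : ℂ[X]) (t : AddCircle (2 * π)) : ℂ :=
  f.eval (t.toCircle : ℂ)

lemma toAddCircle_apply (f : ℂ[X]) (t : AddCircle (2 * π)) :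
    f.toAddCircle t = circleEval f t := by
  induction f using Polynomial.induction_on' with
  | add p q hp hq => simp_all
  | monomial n a => simp [toAddCircle]

lemma continuous_circleEval (f : ℂ[X]) : Continuous (circleEval f) := by
  have h : circleEval f = f.toAddCircle := funext fun t => (toAddCircle_apply f t).symm
  rw [h]
  exact f.toAddCircle.continuous

lemma exists_toCircle_eq {z : ℂ} (hz : ‖z‖ = 1) :
    ∃ t : AddCircle (2 * π), (t.toCircle : ℂ) = z := by
  have h2 : (2 * π : ℝ) ≠ 0 := Real.two_pi_pos.ne'
  let w : Circle := ⟨z, mem_sphere_zero_iff_norm.2 hz⟩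
  refine ⟨(AddCircle.homeomorphCircle h2).symm w, ?_⟩
  rw [← AddCircle.homeomorphCircle_apply h2, Homeomorph.apply_symm_apply]

lemma coeFn_toL1 (f : ℂ[X]) : (toL1 f : AddCircle (2 * π) → ℂ) =ᵐ[circleMeasure] circleEval f := by
  filter_upwards [ContinuousMap.coeFn_toLp (p := 1) (𝕜 := ℂ) circleMeasure f.toAddCircle] with t ht
  rw [← toAddCircle_apply, ← ht]
  rfl

lemma norm_toL1 (f : ℂ[X]) : ‖toL1 f‖ = ∫ t, ‖circleEval f t‖ ∂circleMeasure := by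
  rw [L1.norm_eq_integral_norm]
  refine integral_congr_ae ?_
  filter_upwards [coeFn_toL1 f] with t ht
  rw [ht]

lemma integrable_of_continuous {E : Type*} [NormedAddCommGroup E] {f : AddCircle (2 * π) → E}
    (hf : Continuous f) : Integrable f circleMeasure := by
  simpa using hf.continuousOn.integrableOn_compact isCompact_univ

lemma toL1_injective : Function.Injective toL1 := by
  intro f g h
  have h1 : f.toAddCircle = g.toAddCircle :=
    ContinuousMap.toLp_injective (p := 1) (𝕜 := ℂ) circleMeasure h
  ext n
  rw [← fourierCoeff_toAddCircle_natCast, h1, fourierCoeff_toAddCircle_natCast]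

lemma eq_of_circleEval_eq {f g : ℂ[X]} (h : ∀ t, circleEval f t = circleEval g t) : f = g := by
  have h1 : f.toAddCircle = g.toAddCircle := by
    ext t
    rw [toAddCircle_apply, toAddCircle_apply, h]
  ext n
  rw [← fourierCoeff_toAddCircle_natCast, h1, fourierCoeff_toAddCircle_natCast]

lemma norm_toCircle (t : AddCircle (2 * π)) : ‖(t.toCircle : ℂ)‖ = 1 := Circle.norm_coe _

/-- On the circle f* = z^N conj f, so reality of f conj p is the claimed identity there, and a
polynomial is determined by its values on the circle. -/
lemma mul_pStar_eq_of_real {N : ℕ} {f p : ℂ[X]} (hf : f.natDegree ≤ N) (hp : p.natDegree ≤ N)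
    (h : ∀ t, (circleEval f t * conj (circleEval p t)).im = 0) :
    f * pStar N p = pStar N f * p := by
  refine eq_of_circleEval_eq fun t => ?_
  have h1 := Complex.conj_eq_iff_im.2 (h t)
  simp only [map_mul, Complex.conj_conj] at h1
  simp only [circleEval, eval_mul, eval_pStar hf (norm_toCircle t), eval_pStar hp (norm_toCircle t)]
  linear_combination -(t.toCircle : ℂ) ^ N * h1

/-- A nonnegative product `f * conj p` vanishes to even order on the circle, so `f` vanishes at the
simple zeros of `p`. -/
lemma eval_eq_zero_of_nonneg {f p : ℂ[X]} (hp0 : p ≠ 0) {ζ : ℂ} (hζ : ‖ζ‖ = 1)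
    (hroot : p.eval ζ = 0) (hsimple : p.rootMultiplicity ζ ≤ 1)
    (h : ∀ z : ℂ, ‖z‖ = 1 → 0 ≤ f.eval z * conj (p.eval z)) : f.eval ζ = 0 := by
  have hder : p.derivative.eval ζ ≠ 0 := by
    intro h0
    have := (one_lt_rootMultiplicity_iff_isRoot hp0).2 ⟨hroot, h0⟩
    omega
  have hζ0 : ζ ≠ 0 := by
    rintro rfl
    simp at hζ
  have he : HasDerivAt (fun s : ℂ => ζ * Complex.exp (s * Complex.I)) (ζ * Complex.I)
      ((0 : ℝ) : ℂ) := by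
    have h1 : HasDerivAt (fun s : ℂ => s * Complex.I) Complex.I ((0 : ℝ) : ℂ) := by
      simpa using (hasDerivAt_id ((0 : ℝ) : ℂ)).mul_const Complex.I
    simpa using (h1.cexp.const_mul ζ)
  have hcomp : ∀ q : ℂ[X], HasDerivAt (fun t : ℝ => q.eval (ζ * Complex.exp (t * Complex.I)))
      (q.derivative.eval ζ * (ζ * Complex.I)) 0 := by
    intro q
    have h2 := q.hasDerivAt (ζ * Complex.exp (((0 : ℝ) : ℂ) * Complex.I))
    have h3 := (h2.comp ((0 : ℝ) : ℂ) he).comp_ofReal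
    simpa using h3
  -- Differentiate f conj p along the arc through ζ. As p(ζ) = 0, only f(ζ) times the conjugate
  -- derivative of p survives. It is 0: the real part has a minimum at ζ and the imaginary part is
  -- constant.
  have hF := (hcomp f).mul (hcomp p).star
  have hFre := Complex.reCLM.hasFDerivAt.comp_hasDerivAt (0 : ℝ) hF
  have hFim := Complex.imCLM.hasFDerivAt.comp_hasDerivAt (0 : ℝ) hF
  have hnn : ∀ t : ℝ, 0 ≤ f.eval (ζ * Complex.exp (t * Complex.I)) *
      conj (p.eval (ζ * Complex.exp (t * Complex.I))) := by
    intro t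
    refine h _ ?_
    rw [norm_mul, hζ, Complex.norm_exp_ofReal_mul_I, one_mul]
  have hre : (f.eval ζ * conj (p.derivative.eval ζ * (ζ * Complex.I))).re = 0 := by
    have hmin : IsLocalMin (fun t : ℝ => (f.eval (ζ * Complex.exp (t * Complex.I)) *
        conj (p.eval (ζ * Complex.exp (t * Complex.I)))).re) 0 := by
      refine Filter.Eventually.of_forall fun t => ?_
      simpa [hroot] using (Complex.nonneg_iff.1 (hnn t)).1
    have := hmin.hasDerivAt_eq_zero hFre
    simpa [hroot] using this
  have him : (f.eval ζ * conj (p.derivative.eval ζ * (ζ * Complex.I))).im = 0 := by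
    have hmin : IsLocalMin (fun t : ℝ => (f.eval (ζ * Complex.exp (t * Complex.I)) *
        conj (p.eval (ζ * Complex.exp (t * Complex.I)))).im) 0 := by
      refine Filter.Eventually.of_forall fun t => ?_
      have h1 := (Complex.nonneg_iff.1 (hnn t)).2
      simp only [← h1]
      simp [hroot]
    have := hmin.hasDerivAt_eq_zero hFim
    simpa [hroot] using this
  have hz := Complex.ext (w := 0) hre him
  rcases mul_eq_zero.1 hz with h1 | h1
  · exact h1
  · simp [hder, hζ0] at h1

/-! ### Extreme points, exposed points and functionals -/

lemma IsExtremePt.eq_zero {X : Type*} [NormedAddCommGroup X] [Module ℝ X] {x y : X}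
    (hx : IsExtremePt x) (h1 : ‖x + y‖ ≤ 1) (h2 : ‖x - y‖ ≤ 1) : y = 0 := by
  have h := hx.2 (x₁ := x + y) (by simpa using h1) (x₂ := x - y) (by simpa using h2)
    ⟨1 / 2, 1 / 2, by norm_num, by norm_num, by norm_num, by module⟩
  simpa using h

lemma IsExposedPt.isExtremePt {X : Type*} [NormedAddCommGroup X] [NormedSpace ℂ X] [Module ℝ X]
    [IsScalarTower ℝ ℂ X] {x : X} (hx : IsExposedPt x) : IsExtremePt x := by
  obtain ⟨φ, hφ, hset⟩ := hx
  have hxm : x ∈ {y ∈ Metric.closedBall (0 : X) 1 | φ y = 1} := by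
    rw [hset]
    rfl
  refine ⟨hxm.1, fun x₁ h₁ x₂ h₂ hseg => ?_⟩
  obtain ⟨a, b, ha, hb, hab, rfl⟩ := hseg
  have hsm : ∀ (r : ℝ) (y : X), φ (r • y) = r * φ y := by
    intro r y
    rw [← smul_one_smul ℂ r y, map_smul]
    simp
  have hle : ∀ y ∈ Metric.closedBall (0 : X) 1, ‖φ y‖ ≤ 1 := by
    intro y hy
    refine (φ.le_opNorm y).trans ?_
    rw [hφ, one_mul]
    simpa using hy
  have h := hxm.2
  rw [map_add, hsm, hsm] at h
  have hre : a * (φ x₁).re + b * (φ x₂).re = 1 := by simpa using congrArg Complex.re h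
  have h1 := hle x₁ h₁
  have h2 := (Complex.re_le_norm _).trans (hle x₂ h₂)
  have h1' := (Complex.re_le_norm _).trans h1
  -- Both real parts are at most 1 and their average with positive weights is 1.
  have h3 : (φ x₁).re = 1 := by nlinarith
  have h4 : φ x₁ = 1 := by
    have h5 : ‖φ x₁‖ = (φ x₁).re := by
      linarith [Complex.re_le_norm (φ x₁)]
    have h6 := Complex.re_eq_norm.1 h5.symm
    exact Complex.ext (by simpa using h3) (by simpa using (Complex.nonneg_iff.1 h6).2.symm)
  have : x₁ ∈ {y ∈ Metric.closedBall (0 : X) 1 | φ y = 1} := ⟨h₁, h4⟩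
  rw [hset] at this
  exact this

/-- Integration against a measurable function bounded by `1`, as a functional on `L¹`. -/
noncomputable def pairing (g : AddCircle (2 * π) → ℂ)
    (hg : AEStronglyMeasurable g circleMeasure) (hb : ∀ t, ‖g t‖ ≤ 1) : L1Circle →L[ℂ] ℂ :=
  have hi : ∀ y : L1Circle, Integrable (fun t => g t * y t) circleMeasure := fun y =>
    (L1.integrable_coeFn y).bdd_mul hg (Filter.Eventually.of_forall hb)
  LinearMap.mkContinuous
    { toFun := fun y => ∫ t, g t * y t ∂circleMeasure
      map_add' := fun y z => by
        rw [← integral_add (hi y) (hi z)]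
        refine integral_congr_ae ?_
        filter_upwards [Lp.coeFn_add y z] with t ht
        rw [ht, Pi.add_apply, mul_add]
      map_smul' := fun c y => by
        rw [RingHom.id_apply, ← integral_smul]
        refine integral_congr_ae ?_
        filter_upwards [Lp.coeFn_smul c y] with t ht
        rw [ht, Pi.smul_apply, smul_eq_mul, smul_eq_mul]
        ring }
    1 (fun y => by
      rw [one_mul, L1.norm_eq_integral_norm]
      refine norm_integral_le_of_norm_le (L1.integrable_coeFn y).norm
        (Filter.Eventually.of_forall fun t => ?_)
      rw [norm_mul]
      exact mul_le_of_le_one_left (norm_nonneg _) (hb t))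

lemma norm_pairing_le (g : AddCircle (2 * π) → ℂ)
    (hg : AEStronglyMeasurable g circleMeasure) (hb : ∀ t, ‖g t‖ ≤ 1) : ‖pairing g hg hb‖ ≤ 1 := by
  unfold pairing
  apply LinearMap.mkContinuous_norm_le
  exact zero_le_one

lemma pairing_toL1 (g : AddCircle (2 * π) → ℂ)
    (hg : AEStronglyMeasurable g circleMeasure) (hb : ∀ t, ‖g t‖ ≤ 1) (f : ℂ[X]) :
    pairing g hg hb (toL1 f) = ∫ t, g t * circleEval f t ∂circleMeasure := by
  refine integral_congr_ae ?_
  filter_upwards [coeFn_toL1 f] with t ht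
  rw [ht]

lemma mem_polys_freqs_iff {N M : ℕ} {k : Fin M → ℕ} {f : ℂ[X]} :
    f ∈ polys (freqs N k) ↔ f.natDegree ≤ N ∧ ∀ j, f.coeff (k j) = 0 := by
  constructor
  · intro h
    refine ⟨natDegree_le_iff_coeff_eq_zero.2 fun n hn => h n ?_, fun j => h _ ?_⟩
    · exact fun h' => absurd h'.1 (by omega)
    · exact fun h' => h'.2 j rfl
  · rintro ⟨h1, h2⟩ n hn
    by_cases hnN : n ≤ N
    · by_contra h
      refine hn ⟨hnN, fun j hj => h ?_⟩
      rw [hj, h2]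
    · exact coeff_eq_zero_of_natDegree_lt (by omega)

/-! ### The rank condition and the geometry of the ball -/

section

variable {N M : ℕ} {k : Fin M → ℕ} {p : ℂ[X]}

lemma exists_selfInversive_eq_G (hp0 : p ≠ 0) (hp : p ∈ polys (freqs N k)) :
    ∃ w, w ≠ 0 ∧ selfInversive (m N p) w = G N p ∧ (matM N k p).mulVec w = 0 := by
  rw [mem_polys_freqs_iff] at hp
  obtain ⟨w, hw⟩ := exists_eq_selfInversive (natDegree_G_le N p) (pStar_G N p)
  refine ⟨w, ?_, hw, ?_⟩
  · rintro rfl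
    apply G_ne_zero N p
    rw [← hw]
    simp [selfInversive]
  · rw [matM, blockMatrix_mulVec_eq_zero_iff, hw, G_mul_R hp0 hp.1]
    exact hp.2

/-- If `𝔐` has rank `2m`, the only functions in `𝒫(Λ)` that are real multiples of `p` at each point
of the circle and vanish at the zeros of `p` there are the constant real multiples of `p`. -/
lemma eq_real_mul_of_rank (hp0 : p ≠ 0) (hp : p ∈ polys (freqs N k))
    (hsimple : ∀ ζ : ℂ, ‖ζ‖ = 1 → p.rootMultiplicity ζ ≤ 1)
    (hrank : (matM N k p).rank = 2 * m N p) {f : ℂ[X]} (hf : f ∈ polys (freqs N k))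
    (hreal : ∀ t, (circleEval f t * conj (circleEval p t)).im = 0)
    (hzero : ∀ ζ : ℂ, ‖ζ‖ = 1 → p.eval ζ = 0 → f.eval ζ = 0) :
    ∃ c : ℝ, f = C (c : ℂ) * p := by
  obtain ⟨w, hw0, hwG, hw⟩ := exists_selfInversive_eq_G hp0 hp
  have hp' := mem_polys_freqs_iff.1 hp
  have hf' := mem_polys_freqs_iff.1 hf
  obtain ⟨S, hSd, hS, hfS⟩ := exists_selfInversive_mul_R hp0 hp'.1 hf'.1
    (mul_pStar_eq_of_real hf'.1 hp'.1 hreal) (fun hf0 ζ hζ => by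
      by_cases h : p.eval ζ = 0
      · exact (hsimple ζ hζ).trans ((rootMultiplicity_pos hf0).2 (hzero ζ hζ h))
      · rw [rootMultiplicity_eq_zero h]
        exact Nat.zero_le _)
  obtain ⟨v, rfl⟩ := exists_eq_selfInversive hSd hS
  have hv : (matM N k p).mulVec v = 0 := by
    rw [matM, blockMatrix_mulVec_eq_zero_iff, ← hfS]
    exact hf'.2
  obtain ⟨c, rfl⟩ := (rank_blockMatrix_eq_iff k _ _ hw0 hw).1 hrank v hv
  refine ⟨c, ?_⟩
  -- Taking v = 0 and the scalar -c gives homogeneity of `selfInversive`.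
  have h := selfInversive_sub_smul (m N p) (-c) 0 w
  have h0 : selfInversive (m N p) 0 = 0 := by simp [selfInversive]
  rw [h0] at h
  simp only [neg_smul, sub_neg_eq_add, zero_add, Complex.ofReal_neg, C_neg, neg_mul] at h
  rw [hfS, h, hwG, mul_assoc, G_mul_R hp0 hp'.1]

lemma isExposedPt_of_rank (hp0 : p ≠ 0) (hp : p ∈ polys (freqs N k)) (hnorm : ‖toL1 p‖ = 1)
    (hsimple : ∀ ζ : ℂ, ‖ζ‖ = 1 → p.rootMultiplicity ζ ≤ 1)
    (hrank : (matM N k p).rank = 2 * m N p) :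
    IsExposedPt (toPSpace (freqs N k) p hp) := by
  -- At the zeros of p the quotient is 0 by convention. The identities g p = |p| and f conj p = |p|
  -- g f still hold everywhere, so these points need no separate treatment.
  set g : AddCircle (2 * π) → ℂ := fun t => conj (circleEval p t) / (‖circleEval p t‖ : ℂ) with hgdef
  have hcp := continuous_circleEval p
  have hg : AEStronglyMeasurable g circleMeasure := by
    refine Measurable.aestronglyMeasurable ?_
    refine Measurable.div ?_ ?_
    · exact (Complex.continuous_conj.comp hcp).measurable
    · exact (Complex.continuous_ofReal.comp hcp.norm).measurable
  have hb : ∀ t, ‖g t‖ ≤ 1 := by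
    intro t
    simp only [hgdef, norm_div, RCLike.norm_conj, Complex.norm_real, norm_norm]
    exact div_self_le_one _
  set φ : StrongDual ℂ (PSpace (freqs N k)) :=
    (pairing g hg hb).comp (PSpace (freqs N k)).subtypeL with hφdef
  have hφ : ∀ (f : ℂ[X]) (hf : f ∈ polys (freqs N k)),
      φ (toPSpace _ f hf) = ∫ t, g t * circleEval f t ∂circleMeasure :=
    fun f hf => pairing_toL1 g hg hb f
  have hgp : ∀ t, g t * circleEval p t = (‖circleEval p t‖ : ℂ) := by
    intro t
    by_cases h : circleEval p t = 0
    · simp [h]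
    · have h' : (‖circleEval p t‖ : ℂ) ≠ 0 := by simpa using h
      simp only [hgdef]
      rw [div_mul_eq_mul_div, div_eq_iff h', Complex.conj_mul']
      ring
  have hφp : φ (toPSpace _ p hp) = 1 := by
    rw [hφ]
    simp_rw [hgp]
    rw [integral_complex_ofReal, ← norm_toL1, hnorm, Complex.ofReal_one]
  have hnp : ‖toPSpace (freqs N k) p hp‖ = 1 := hnorm
  have hφ1 : ‖φ‖ ≤ 1 := by
    refine φ.opNorm_le_bound zero_le_one fun y => ?_
    exact (pairing g hg hb).le_of_opNorm_le (norm_pairing_le g hg hb) (y : L1Circle)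
  refine ⟨φ, le_antisymm hφ1 ?_, ?_⟩
  · have := φ.le_opNorm (toPSpace _ p hp)
    rwa [hφp, hnp, norm_one, mul_one] at this
  ext y
  constructor
  · rintro ⟨hy1, hy2⟩
    obtain ⟨y, f, hf, rfl⟩ := y
    change φ (toPSpace _ f hf) = 1 at hy2
    have hfn : ‖toL1 f‖ ≤ 1 := by simpa using hy1
    have hcf := continuous_circleEval f
    have hint : Integrable (fun t => g t * circleEval f t) circleMeasure :=
      (integrable_of_continuous hcf).bdd_mul hg (Filter.Eventually.of_forall hb)
    have hintre : Integrable (fun t => (g t * circleEval f t).re) circleMeasure := hint.re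
    have hnn : ∀ t, 0 ≤ ‖circleEval f t‖ - (g t * circleEval f t).re := by
      intro t
      have h1 := Complex.re_le_norm (g t * circleEval f t)
      rw [norm_mul] at h1
      have h2 := mul_le_of_le_one_left (norm_nonneg (circleEval f t)) (hb t)
      linarith
    -- The integral is ‖f‖ - Re φ(f) ≤ 1 - 1, and the integrand is nonnegative.
    have hz : ∫ t, (‖circleEval f t‖ - (g t * circleEval f t).re) ∂circleMeasure = 0 := by
      refine le_antisymm ?_ (integral_nonneg hnn)
      rw [integral_sub (integrable_of_continuous hcf.norm) hintre, ← norm_toL1]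
      have h1 : ∫ t, (g t * circleEval f t).re ∂circleMeasure = 1 := by
        have := integral_re hint
        rw [hφ] at hy2
        rw [hy2] at this
        simpa using this
      linarith
    have hae := (integral_eq_zero_iff_of_nonneg hnn
      ((integrable_of_continuous hcf.norm).sub hintre)).1 hz
    -- Multiplication by |p| replaces g f, possibly discontinuous at zeros of p, by the continuous f
    -- conj p, so the almost everywhere equality holds everywhere.
    have hcont : (fun t => ‖circleEval f t * conj (circleEval p t)‖) =
        fun t => (circleEval f t * conj (circleEval p t)).re := by
      have hc := hcf.mul (Complex.continuous_conj.comp hcp)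
      refine (Continuous.ae_eq_iff_eq circleMeasure hc.norm (Complex.continuous_re.comp hc)).1 ?_
      filter_upwards [hae] with t ht
      have ht' : ‖circleEval f t‖ = (g t * circleEval f t).re := by simpa [sub_eq_zero] using ht
      have h1 : circleEval f t * conj (circleEval p t) =
          (‖circleEval p t‖ : ℂ) * (g t * circleEval f t) := by
        by_cases h : circleEval p t = 0
        · simp [h]
        · have h' : (‖circleEval p t‖ : ℂ) ≠ 0 := by simpa using h
          simp only [hgdef]
          field_simp
      have h2 : ‖g t * circleEval f t‖ = (g t * circleEval f t).re := by
        refine le_antisymm ?_ (Complex.re_le_norm _)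
        rw [← ht', norm_mul]
        exact mul_le_of_le_one_left (norm_nonneg _) (hb t)
      change ‖circleEval f t * conj (circleEval p t)‖ =
        (circleEval f t * conj (circleEval p t)).re
      rw [h1, Complex.re_ofReal_mul, norm_mul, Complex.norm_real, norm_norm, h2]
    have hpos : ∀ t, 0 ≤ circleEval f t * conj (circleEval p t) := fun t =>
      Complex.re_eq_norm.1 (congrFun hcont t).symm
    obtain ⟨c, rfl⟩ := eq_real_mul_of_rank hp0 hp hsimple hrank hf
      (fun t => (Complex.nonneg_iff.1 (hpos t)).2.symm) (fun ζ hζ h => by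
        refine eval_eq_zero_of_nonneg hp0 hζ h (hsimple ζ hζ) fun z hz => ?_
        obtain ⟨t, rfl⟩ := exists_toCircle_eq hz
        exact hpos t)
    have hsm : toPSpace (freqs N k) (C (c : ℂ) * p) hf = (c : ℂ) • toPSpace (freqs N k) p hp := by
      apply Subtype.ext
      change toL1 (C (c : ℂ) * p) = (c : ℂ) • toL1 p
      rw [← smul_eq_C_mul, map_smul]
    change toPSpace (freqs N k) (C (c : ℂ) * p) hf = _
    rw [hsm, map_smul, hφp, smul_eq_mul, mul_one] at hy2
    rw [hsm, hy2, one_smul]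
  · rintro rfl
    exact ⟨by simpa using hnp.le, hφp⟩

lemma rank_of_isExtremePt (hp0 : p ≠ 0) (hp : p ∈ polys (freqs N k)) (hnorm : ‖toL1 p‖ = 1)
    (hext : IsExtremePt (toPSpace (freqs N k) p hp)) :
    (matM N k p).rank = 2 * m N p := by
  obtain ⟨w, hw0, hwG, hw⟩ := exists_selfInversive_eq_G hp0 hp
  have hp' := mem_polys_freqs_iff.1 hp
  refine (rank_blockMatrix_eq_iff k _ _ hw0 hw).2 fun v hv => ?_
  set S := selfInversive (m N p) v with hSdef
  have hS := pStar_selfInversive (m N p) v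
  have hSd := natDegree_selfInversive_le (m N p) v
  rw [← hSdef] at hS hSd
  have hq : S * R N p ∈ polys (freqs N k) := by
    rw [mem_polys_freqs_iff]
    refine ⟨natDegree_mul_le.trans ?_, (blockMatrix_mulVec_eq_zero_iff k _ _ v).1 hv⟩
    have := natDegree_R_add_le hp0 hp'.1
    omega
  have hG0 : ∀ t, circleEval (G N p) t ≠ 0 := by
    intro t h
    have h1 := (rootMultiplicity_pos (G_ne_zero N p)).2 h
    rw [rootMultiplicity_G_of_eq (norm_toCircle t)] at h1
    exact lt_irrefl _ h1
  -- S and G are self-inversive of the same order, so S/G is already real and taking the real part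
  -- loses nothing.
  set h : AddCircle (2 * π) → ℝ := fun t => (circleEval S t / circleEval (G N p) t).re with hhdef
  have hcont : Continuous h :=
    Complex.continuous_re.comp ((continuous_circleEval S).div (continuous_circleEval _) hG0)
  have hhS : ∀ t, circleEval S t = h t * circleEval (G N p) t := by
    intro t
    have h1 := eval_pStar hSd (norm_toCircle t)
    have h2 := eval_pStar (natDegree_G_le N p) (norm_toCircle t)
    rw [hS] at h1
    rw [pStar_G] at h2
    have h3 : conj (circleEval S t / circleEval (G N p) t) =
        circleEval S t / circleEval (G N p) t := by
      have h4 : conj (circleEval (G N p) t) ≠ 0 := by simpa using hG0 t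
      rw [map_div₀, div_eq_div_iff h4 (hG0 t)]
      have h5 : circleEval S t = (t.toCircle : ℂ) ^ (2 * m N p) * conj (circleEval S t) := h1
      have h6 : circleEval (G N p) t =
        (t.toCircle : ℂ) ^ (2 * m N p) * conj (circleEval (G N p) t) := h2
      linear_combination conj (circleEval S t) * h6 - conj (circleEval (G N p) t) * h5
    rw [hhdef]
    simp only
    rw [Complex.conj_eq_iff_re.1 h3, div_mul_cancel₀ _ (hG0 t)]
  have hqe : ∀ t, circleEval (S * R N p) t = h t * circleEval p t := by
    intro t
    have h1 : circleEval p t = circleEval (G N p) t * circleEval (R N p) t := by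
      rw [← eval_mul, G_mul_R hp0 hp'.1]
    rw [h1, circleEval, eval_mul]
    change circleEval S t * circleEval (R N p) t = _
    rw [hhS]
    ring
  have hcp := (continuous_circleEval p).norm
  -- As ‖p‖ = 1, this choice makes the integral of |p|(h - c) vanish, so the perturbation does not
  -- change the norm.
  set c : ℝ := ∫ t, ‖circleEval p t‖ * h t ∂circleMeasure with hcdef
  obtain ⟨B, hB⟩ : ∃ B, ∀ t, |h t - c| ≤ B := by
    obtain ⟨B, hB⟩ := isCompact_univ.exists_bound_of_continuousOn
      (hcont.sub continuous_const).continuousOn (f := fun t => h t - c)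
    exact ⟨B, fun t => hB t (Set.mem_univ t)⟩
  have hB0 : 0 ≤ B := (abs_nonneg _).trans (hB 0)
  -- Small enough that 1 ± ε(h - c) ≥ 0, which removes the absolute value; B + 1 avoids dividing by
  -- 0.
  set ε : ℝ := 1 / (B + 1) with hεdef
  have hε : 0 < ε := by positivity
  have hεB : ∀ t, |ε * (h t - c)| ≤ 1 := by
    intro t
    rw [abs_mul, abs_of_pos hε, hεdef, one_div, inv_mul_le_iff₀ (by positivity), mul_one]
    linarith [hB t]
  set q : ℂ[X] := S * R N p - C (c : ℂ) * p with hqdef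
  have hqm : q ∈ polys (freqs N k) := by
    rw [hqdef, ← smul_eq_C_mul]
    exact Submodule.sub_mem _ hq (Submodule.smul_mem _ _ hp)
  have hnorm1 : ∀ s : ℝ, |s| = ε → ‖toL1 (p + C (s : ℂ) * q)‖ = 1 := by
    intro s hs
    have h1 : ∀ t, ‖circleEval (p + C (s : ℂ) * q) t‖ =
        ‖circleEval p t‖ + s * (‖circleEval p t‖ * h t - c * ‖circleEval p t‖) := by
      intro t
      have h2 : circleEval (p + C (s : ℂ) * q) t =
          ((1 + s * (h t - c) : ℝ) : ℂ) * circleEval p t := by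
        have h3 := hqe t
        simp only [circleEval, hqdef, eval_add, eval_sub, eval_mul, eval_C] at h3 ⊢
        rw [h3]
        push_cast
        ring
      have h4 : |s * (h t - c)| ≤ 1 := by
        have := hεB t
        rwa [abs_mul, abs_of_pos hε, ← hs, ← abs_mul] at this
      rw [h2, norm_mul, Complex.norm_real, Real.norm_eq_abs,
        abs_of_nonneg (by linarith [(abs_le.1 h4).1])]
      ring
    rw [norm_toL1]
    simp_rw [h1]
    have hi1 := integrable_of_continuous hcp
    have hi2 : Integrable (fun t => ‖circleEval p t‖ * h t) circleMeasure :=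
      integrable_of_continuous (hcp.mul hcont)
    have hi3 : Integrable (fun t => ‖circleEval p t‖ * h t - c * ‖circleEval p t‖) circleMeasure :=
      hi2.sub (hi1.const_mul c)
    rw [integral_add hi1 (hi3.const_mul s), integral_const_mul,
      integral_sub hi2 (hi1.const_mul c), integral_const_mul, ← norm_toL1, hnorm, ← hcdef]
    ring
  have hy := hext.eq_zero (y := toPSpace (freqs N k) (C (ε : ℂ) * q)
      (by rw [← smul_eq_C_mul]; exact Submodule.smul_mem _ _ hqm))
    (by
      change ‖toL1 p + toL1 (C (ε : ℂ) * q)‖ ≤ 1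
      rw [← map_add, hnorm1 ε (abs_of_pos hε)])
    (by
      change ‖toL1 p - toL1 (C (ε : ℂ) * q)‖ ≤ 1
      have := hnorm1 (-ε) (by rw [abs_neg, abs_of_pos hε])
      rw [← map_sub, sub_eq_add_neg, ← neg_mul, ← C_neg, ← Complex.ofReal_neg, this])
  have hq0 : C (ε : ℂ) * q = 0 := by
    apply toL1_injective
    rw [map_zero]
    exact congrArg Subtype.val hy
  have hq1 : q = 0 := by simpa [hε.ne'] using hq0
  refine ⟨c, sub_eq_zero.1 (eq_zero_of_selfInversive_eq_zero ?_)⟩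
  rw [selfInversive_sub_smul, hwG, ← hSdef]
  apply mul_right_cancel₀ (R_ne_zero hp0 hp'.1)
  rw [sub_mul, mul_assoc, G_mul_R hp0 hp'.1, zero_mul]
  exact hq1

/-! ### Simple zeros on the circle: the objects with a tilde -/

lemma halfMult_eq_zero (hsimple : ∀ ζ : ℂ, ‖ζ‖ = 1 → p.rootMultiplicity ζ ≤ 1) {ζ : ℂ}
    (hζ : ζ ∈ circleZeros p) : halfMult p ζ = 0 := by
  simp only [circleZeros, Finset.mem_filter] at hζ
  have := hsimple ζ hζ.2
  unfold halfMult
  omega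

lemma mTilde_eq (hsimple : ∀ ζ : ℂ, ‖ζ‖ = 1 → p.rootMultiplicity ζ ≤ 1) :
    mTilde N p = m N p := by
  rw [mTilde, Finset.sum_eq_zero fun ζ hζ => halfMult_eq_zero hsimple hζ, add_zero]

lemma RTilde_eq (hsimple : ∀ ζ : ℂ, ‖ζ‖ = 1 → p.rootMultiplicity ζ ≤ 1) :
    RTilde N p = R N p := by
  rw [RTilde, R, GTilde, G0, Finset.prod_eq_one, mul_one]
  intro ζ hζ
  rw [halfMult_eq_zero hsimple hζ, pow_zero, pow_zero, one_mul]

/-- The column types depend on d, so equality of the two matrices is expressed by relabelling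
columns along d = e. -/
lemma blockMatrix_submatrix_cast (k : Fin M → ℕ) (f : ℂ[X]) {d e : ℕ} (h : d = e) :
    (blockMatrix k d f).submatrix id
      (Sum.map (Fin.cast (congrArg (· + 1) h.symm)) (Fin.cast h.symm)) = blockMatrix k e f := by
  subst h
  ext i (j | j) <;> rfl

end

end Fewnomial

theorem proposition3p3 (N : ℕ) (hN : 0 < N) (M : ℕ) (k : Fin M → ℕ) (hk : StrictMono k)
    (hkN : ∀ j, 0 < k j ∧ k j < N)
    (p : ℂ[X]) (hp : p ∈ Fewnomial.polys (Fewnomial.freqs N k))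
    (hnorm : ‖Fewnomial.toL1 p‖ = 1)
    (hsimple : ∀ ζ : ℂ, ‖ζ‖ = 1 → p.rootMultiplicity ζ ≤ 1) :
    (Fewnomial.IsExposedPt (Fewnomial.toPSpace (Fewnomial.freqs N k) p hp) ↔
      Fewnomial.IsExtremePt (Fewnomial.toPSpace (Fewnomial.freqs N k) p hp)) ∧
    (∃ h : Fewnomial.mTilde N p = Fewnomial.m N p,
      (Fewnomial.matMTilde N k p).submatrix id
        (Sum.map (Fin.cast (congrArg (· + 1) h.symm)) (Fin.cast h.symm)) =
          Fewnomial.matM N k p) ∧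
    (Fewnomial.IsExtremePt (Fewnomial.toPSpace (Fewnomial.freqs N k) p hp) ↔
      (Fewnomial.matM N k p).rank = 2 * Fewnomial.m N p) ∧
    ((Fewnomial.matMTilde N k p).rank = 2 * Fewnomial.mTilde N p →
      Fewnomial.IsExposedPt (Fewnomial.toPSpace (Fewnomial.freqs N k) p hp)) := by
  have hp0 : p ≠ 0 := by
    rintro rfl
    simp at hnorm
  have hexp := Fewnomial.isExposedPt_of_rank hp0 hp hnorm hsimple
  have hrank := Fewnomial.rank_of_isExtremePt hp0 hp hnorm
  have hm : Fewnomial.mTilde N p = Fewnomial.m N p := Fewnomial.mTilde_eq hsimple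
  refine ⟨⟨fun h => h.isExtremePt, fun h => hexp (hrank h)⟩, ⟨hm, ?_⟩,
    ⟨hrank, fun h => (hexp h).isExtremePt⟩, fun h => hexp ?_⟩
  · rw [Fewnomial.matMTilde, Fewnomial.RTilde_eq hsimple, Fewnomial.blockMatrix_submatrix_cast _ _ hm]
    rfl
  · rw [Fewnomial.matMTilde, Fewnomial.RTilde_eq hsimple, hm] at h
    exact h
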